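/- Let $U=[0,1]$. A function $g$ from the set of all finite sequences of elements of $U$ to $U$ is called argumentation-friendly if (T1) $g(\varnothing)=1$; (T2) $g(1;\Delta)=g(\Delta)$ for every finite sequence $\Delta$; (T3) exchanging two entries of a sequence does not change the value of $g$; (T4) $g(\Delta)=0$ if and only if $0$ is an entry of $\Delta$; (T5) $g(\Delta)=1$ if and only if every entry of $\Delta$ equals $1$; (T6) for every $n$, the restriction of $g$ to $U^n$ is continuous. An argumentation network is a pair $\langle S,R\rangle$, where $S$ is a finite set and $R\subseteq S\times S$; if $(X,Y)\in R$, then $X$ attacks $Y$. Write $\mathrm{Att}(X)=\{Y\in S : (Y,X)\in R\}$, and for $E\subseteq S$ write $E\rightarrow X$ if some $Y\in E$ attacks $X$. A node $X$ is acceptable with respect to $E$ if $E\rightarrow Y$ for every $Y\in\mathrm{Att}(X)$. The set $E$ is a complete extension if no member of $E$ attacks a member of $E$, every member of $E$ is acceptable with respect to $E$, and every node acceptable with respect to $E$ belongs to $E$. A preferred extension is a complete extension that is maximal with respect to inclusion among all complete extensions. Theorem. Let $\langle S,R\rangle$ be an argumentation network and let $g$ be an argumentation-friendly function. Consider the system of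 equations $$V(X)=g\big((1-V(Y))_{Y\in\mathrm{Att}(X)}\big)\qquad (X\in S),$$ with one entry of the sequence on the right for each attacker $Y$ of $X$ (the order is irrelevant by (T3)). Then for every preferred extension $E$ of $\langle S,R\rangle$ there is a solution $V:S\to[0,1]$ of the system such that, for every $X\in S$, (C1) if $X\in E$, then $V(X)=1$; (C2) if $E\rightarrow X$, then $V(X)=0$; (C3) if $X\notin E$ and $E\not\rightarrow X$, then $0<V(X)<1$. -/

import Mathlib

namespace Argumentation

/-! An argumentation network `⟨S, R⟩` is a type `S` of arguments with an attack relation `R`;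
`R X Y` means that `X` attacks `Y`. -/

section Extensions

variable {S : Type*} (R : S → S → Prop)

/-- `E → X`: some member of `E` attacks `X`. -/
def SetAttacks (E : Set S) (X : S) : Prop :=
  ∃ Y ∈ E, R Y X

/-- No member of `E` attacks a member of `E`. -/
def ConflictFree (E : Set S) : Prop :=
  ∀ X ∈ E, ∀ Y ∈ E, ¬ R X Y

/-- `X` is acceptable with respect to `E`: every attacker of `X` is attacked by `E`. -/
def Acceptable (E : Set S) (X : S) : Prop :=
  ∀ Y, R Y X → ∃ Z ∈ E, R Z Y

/-- `E` is conflict-free and all of its elements are acceptable with respect to it. -/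
def Admissible (E : Set S) : Prop :=
  ConflictFree R E ∧ ∀ X ∈ E, Acceptable R E X

/-- An admissible set that contains all arguments acceptable with respect to it. -/
def CompleteExtension (E : Set S) : Prop :=
  Admissible R E ∧ ∀ X, Acceptable R E X → X ∈ E

/-- A complete extension that is maximal for inclusion among all complete extensions. -/
def PreferredExtension (E : Set S) : Prop :=
  Maximal (CompleteExtension R) E

end Extensions

/-- Argumentation-friendly functions: functions from the finite sequences of elements of
`U = [0, 1]` to `U` that satisfy the conditions (T1)-(T6). -/
structure ArgumentationFriendly (g : List unitInterval → unitInterval) : Prop where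
  /-- (T1) -/
  empty : g [] = 1
  /-- (T2) -/
  one_cons : ∀ Δ : List unitInterval, g (1 :: Δ) = g Δ
  /-- (T3): exchanging two entries of a sequence does not change the value. -/
  exchange : ∀ (a b c : List unitInterval) (x y : unitInterval),
    g (a ++ x :: (b ++ y :: c)) = g (a ++ y :: (b ++ x :: c))
  /-- (T4) -/
  eq_zero_iff : ∀ Δ : List unitInterval, g Δ = 0 ↔ 0 ∈ Δ
  /-- (T5) -/
  eq_one_iff : ∀ Δ : List unitInterval, g Δ = 1 ↔ ∀ x ∈ Δ, x = 1
  /-- (T6): `g` is continuous as a function of `n` variables, for every `n`. -/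
  continuous : ∀ n : ℕ, Continuous fun x : Fin n → unitInterval => g (List.ofFn x)

/-- The value of an argumentation-friendly function does not depend on the order of the entries. -/
theorem ArgumentationFriendly.eq_of_perm {g : List unitInterval → unitInterval}
    (hg : ArgumentationFriendly g) {l₁ l₂ : List unitInterval} (h : l₁.Perm l₂) :
    g l₁ = g l₂ := by
  have key : ∀ a : List unitInterval, g (a ++ l₁) = g (a ++ l₂) := by
    induction h with
    | nil => intro a; rfl
    | cons x _ ih => intro a; simpa using ih (a ++ [x])
    | swap x y l => intro a; exact hg.exchange a [] l y x
    | trans _ _ ih₁ ih₂ => intro a; exact (ih₁ a).trans (ih₂ a)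
  exact key []

/-- The set `Att(X)` of the attackers of `X`, as a finset. -/
noncomputable def attackers {S : Type*} [Finite S] (R : S → S → Prop) (X : S) : Finset S :=
  (Set.toFinite {Y | R Y X}).toFinset

/-- `V` solves the system of equations `V(X) = g_{Y ∈ Att(X)} (1 - V(Y))`, one for each node `X`.
The values `1 - V(Y)` form a sequence with one entry for each attacker `Y` (so values that several
attackers share are repeated); the order that `Finset.toList` picks is irrelevant for the functions
considered here, by `ArgumentationFriendly.eq_of_perm`. `unitInterval.symm v` is `1 - v`. -/
def IsSolution {S : Type*} [Finite S] (R : S → S → Prop) (g : List unitInterval → unitInterval)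
    (V : S → unitInterval) : Prop :=
  ∀ X, V X = g ((attackers R X).toList.map fun Y => unitInterval.symm (V Y))

end Argumentation

/-! Prescribe the value 1 on `E` and 0 on the nodes `E` attacks, and let the equations govern the
rest. This is a continuous self-map of a cube, with a fixed point by Brouwer. Conflict-freeness
makes the prescription consistent; acceptability, (T4) and (T5) make the prescribed values satisfy
their own equations (`Admissible.exists_isSolution`). In any solution the nodes of value 1 form a
complete extension (`IsSolution.completeExtension`); here it contains `E`, so by maximality it is
`E`. A node of value 0 has an attacker of value 1, hence in `E`, so the remaining values lie
strictly between 0 and 1.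

Brouwer rests on a volume argument. If `f` retracted the ball smoothly onto the sphere and `h = f -
id`, then `id + t h` would permute the open ball for small `t > 0`, so the integral of `det (1 + t
Dh)` would be the volume of the ball. It is polynomial in `t`, so this would persist at `t = 1`,
where `det Df = 0`. -/

section Brouwer

open Metric Set MeasureTheory Topology
open scoped ContDiff

/-! ### Determinants of perturbations of the identity -/

/-- The determinant of `1 + A` is a fixed affine combination of the determinants of `1 + t • A`,
for finitely many arbitrarily small positive `t`. -/
theorem exists_det_one_add_eq_sum (E : Type*) [NormedAddCommGroup E] [NormedSpace ℝ E]
    [FiniteDimensional ℝ E] {ε : ℝ} (hε : 0 < ε) :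
    ∃ (s : Finset ℝ) (w : ℝ → ℝ), (∀ t ∈ s, 0 < t ∧ t < ε) ∧ ∑ t ∈ s, w t = 1 ∧
      ∀ A : E →L[ℝ] E, (1 + A).det = ∑ t ∈ s, w t * (1 + t • A).det := by
  -- `det (1 + t A)` has degree at most `finrank` in `t`, so Lagrange interpolation at `finrank + 1`
  -- nodes recovers its value at 1, with weights independent of `A`.
  obtain ⟨s, hs, hcard⟩ := (Ioo_infinite hε).exists_subset_card_eq (Module.finrank ℝ E + 1)
  have hinj : Set.InjOn (id : ℝ → ℝ) s := Function.injective_id.injOn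
  have hne : s.Nonempty := Finset.card_pos.1 (by omega)
  refine ⟨s, fun t => (Lagrange.basis s id t).eval 1, fun t ht => hs ht, ?_, fun A => ?_⟩
  · rw [← Polynomial.eval_finsetSum, Lagrange.sum_basis hinj hne, Polynomial.eval_one]
  · let b := Module.finBasis ℝ E
    let M := LinearMap.toMatrix b b (A : E →ₗ[ℝ] E)
    let p : Polynomial ℝ := Matrix.det ((Polynomial.X : Polynomial ℝ) • M.map Polynomial.C
      + (1 : Matrix _ _ ℝ).map Polynomial.C)
    have hp : ∀ t : ℝ, p.eval t = (1 + t • A).det := by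
      intro t
      have h1 : (1 + t • A).det = LinearMap.det (1 + t • (A : E →ₗ[ℝ] E)) := rfl
      rw [h1, ← LinearMap.det_toMatrix b, map_add, map_smul, LinearMap.toMatrix_one]
      simp only [p]
      rw [← Polynomial.coe_evalRingHom, RingHom.map_det]
      congr 1
      ext i j
      by_cases hij : i = j <;> simp [hij, M] <;> ring
    have hdeg : p.degree < s.card := by
      refine Polynomial.degree_le_natDegree.trans_lt (Nat.cast_lt.2 ?_)
      rw [hcard, Nat.lt_succ_iff]
      exact (Polynomial.natDegree_det_X_add_C_le M 1).trans_eq (Fintype.card_fin _)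
    have h2 := congrArg (Polynomial.eval 1) (Lagrange.eq_interpolate hinj hdeg)
    rw [hp, one_smul, Lagrange.interpolate_apply, Polynomial.eval_finsetSum] at h2
    rw [h2]
    refine Finset.sum_congr rfl fun t _ => ?_
    simp [hp, mul_comm]

/-- If `‖A‖ < 1`, then `1 + A` is onto and its determinant is positive. -/
theorem det_one_add_pos {E : Type*} [NormedAddCommGroup E] [NormedSpace ℝ E]
    [FiniteDimensional ℝ E] {A : E →L[ℝ] E} (hA : ‖A‖ < 1) :
    IsUnit (1 + A) ∧ 0 < (1 + A).det := by
  have : CompleteSpace E := FiniteDimensional.complete ℝ E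
  have hu : ∀ s ∈ Icc (0 : ℝ) 1, IsUnit (1 + s • A) := by
    intro s hs
    have h : ‖-(s • A)‖ < 1 := by
      rw [norm_neg, norm_smul, Real.norm_of_nonneg hs.1]
      nlinarith [hs.2, norm_nonneg A]
    simpa using isUnit_one_sub_of_norm_lt_one h
  have hne : ∀ s ∈ Icc (0 : ℝ) 1, (1 + s • A).det ≠ 0 := by
    intro s hs
    exact (LinearMap.isUnit_det _
      ((hu s hs).map (ContinuousLinearMap.toLinearMapRingHom (R₁ := ℝ) (M₁ := E)))).ne_zero
  have hc : Continuous fun s : ℝ => (1 + s • A).det := by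
    exact ContinuousLinearMap.continuous_det.comp (by fun_prop)
  refine ⟨by simpa using hu 1 (by simp), ?_⟩
  -- The determinant is 1 at `s = 0` and never vanishes along the segment, so it cannot change sign.
  by_contra hneg
  obtain ⟨s, hs, hs0⟩ := intermediate_value_Icc' (zero_le_one' ℝ) hc.continuousOn
    (show (0 : ℝ) ∈ Icc _ _ by
      constructor
      · simpa using hneg
      · simp [ContinuousLinearMap.det])
  exact hne s hs hs0

/-! ### No-retraction theorem and Brouwer's fixed point theorem -/

variable {E : Type*} [NormedAddCommGroup E] [InnerProductSpace ℝ E] [FiniteDimensional ℝ E]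

/-- A small multiple of a perturbation that vanishes on the unit sphere, added to the identity,
maps the open unit ball bijectively to itself. -/
theorem image_ball_add_smul {h : E → E} {C : NNReal} {t : ℝ} (ht0 : 0 < t) (ht1 : t < 1)
    (htC : t * C < 1) (hsm : ∀ x ∈ closedBall (0 : E) 1, ContDiffAt ℝ 1 h x)
    (hbd : ∀ x ∈ closedBall (0 : E) 1, ‖fderiv ℝ h x‖₊ ≤ C)
    (hmaps : ∀ x ∈ closedBall (0 : E) 1, ‖x + h x‖ ≤ 1)
    (hsph : ∀ x : E, ‖x‖ = 1 → h x = 0) :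
    InjOn (fun x => x + t • h x) (closedBall (0 : E) 1) ∧
      (fun x => x + t • h x) '' ball (0 : E) 1 = ball 0 1 := by
  have : CompleteSpace E := FiniteDimensional.complete ℝ E
  have hlip : LipschitzOnWith C h (closedBall (0 : E) 1) :=
    Convex.lipschitzOnWith_of_nnnorm_fderiv_le
      (fun x hx => (hsm x hx).differentiableAt one_ne_zero) hbd (convex_closedBall _ _)
  have hinj : InjOn (fun x => x + t • h x) (closedBall (0 : E) 1) := by
    intro x hx y hy hxy
    have h1 : x - y = t • (h y - h x) := by
      rw [smul_sub, sub_eq_sub_iff_add_eq_add]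
      simpa [add_comm] using hxy
    have h2 : ‖h y - h x‖ ≤ C * ‖x - y‖ := by
      rw [← dist_eq_norm, ← dist_eq_norm, dist_comm x y]
      exact hlip.dist_le_mul y hy x hx
    have h3 : ‖x - y‖ ≤ t * C * ‖x - y‖ := by
      calc ‖x - y‖ = t * ‖h y - h x‖ := by
            conv_lhs => rw [h1, norm_smul, Real.norm_of_nonneg ht0.le]
        _ ≤ t * (C * ‖x - y‖) := by gcongr
        _ = _ := by ring
    have h4 : ‖x - y‖ = 0 := by nlinarith [norm_nonneg (x - y)]
    exact sub_eq_zero.1 (norm_eq_zero.1 h4)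
  have hball : MapsTo (fun x => x + t • h x) (ball (0 : E) 1) (ball 0 1) := by
    intro x hx
    rw [mem_ball_zero_iff] at hx ⊢
    have h1 : x + t • h x = (1 - t) • x + t • (x + h x) := by module
    have h2 := hmaps x (by simpa using hx.le)
    calc ‖x + t • h x‖ ≤ ‖(1 - t) • x‖ + ‖t • (x + h x)‖ := by rw [h1]; exact norm_add_le _ _
      _ = (1 - t) * ‖x‖ + t * ‖x + h x‖ := by
          rw [norm_smul, norm_smul, Real.norm_of_nonneg ht0.le,
            Real.norm_of_nonneg (by linarith : 0 ≤ 1 - t)]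
      _ < 1 := by nlinarith
  refine ⟨hinj, hball.image_subset.antisymm ?_⟩
  -- The image is open by the inverse function theorem, and relatively closed in the ball because
  -- the unit sphere is fixed pointwise.
  refine (convex_ball (0 : E) 1).isPreconnected.subset_of_closure_inter_subset ?_ ?_ ?_
  · rw [isOpen_iff_mem_nhds]
    rintro _ ⟨x, hx, rfl⟩
    have hx' := ball_subset_closedBall hx
    have hd : HasStrictFDerivAt (fun x => x + t • h x) (1 + t • fderiv ℝ h x) x :=
      (hasStrictFDerivAt_id x).add
        (((hsm x hx').hasStrictFDerivAt one_ne_zero).const_smul t)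
    have hu : IsUnit (1 + t • fderiv ℝ h x) := by
      refine (det_one_add_pos ?_).1
      rw [norm_smul, Real.norm_of_nonneg ht0.le]
      have : ‖fderiv ℝ h x‖ ≤ C := hbd x hx'
      nlinarith
    have hsurj : (1 + t • fderiv ℝ h x).range = ⊤ := by
      rw [LinearMap.range_eq_top]
      obtain ⟨u, hu⟩ := hu
      intro y
      refine ⟨(↑u⁻¹ : E →L[ℝ] E) y, ?_⟩
      rw [← hu]
      exact congrArg (fun L : E →L[ℝ] E => L y) u.mul_inv
    rw [← hd.map_nhds_eq_of_surj hsurj]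
    exact Filter.image_mem_map (isOpen_ball.mem_nhds hx)
  · refine ⟨(0 : E) + t • h 0, hball (by simp), mem_image_of_mem (fun x => x + t • h x) (by simp)⟩
  · rintro y ⟨hy, hyb⟩
    have hcl : IsClosed ((fun x => x + t • h x) '' closedBall (0 : E) 1) := by
      refine ((isCompact_closedBall _ _).image_of_continuousOn ?_).isClosed
      exact continuousOn_id.add (hlip.continuousOn.const_smul t)
    obtain ⟨x, hx, rfl⟩ := closure_minimal (image_mono ball_subset_closedBall) hcl hy
    rw [mem_closedBall_zero_iff] at hx
    rcases hx.lt_or_eq with hx | hx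
    · exact mem_image_of_mem (fun x => x + t • h x) (by simpa using hx)
    · simp [hsph x hx, hx] at hyb

/-- There is no smooth retraction of the closed unit ball onto the unit sphere. -/
theorem no_contDiff_retraction {f : E → E}
    (hsm : ∀ x ∈ closedBall (0 : E) 1, ContDiffAt ℝ 1 f x)
    (hf : ∀ x ∈ closedBall (0 : E) 1, ‖f x‖ = 1) (hsph : ∀ x : E, ‖x‖ = 1 → f x = x) : False := by
  let _ : MeasurableSpace E := borel E
  have : BorelSpace E := ⟨rfl⟩
  let μ : Measure E := Measure.addHaar
  have hK : IsCompact (closedBall (0 : E) 1) := isCompact_closedBall _ _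
  set h : E → E := fun x => f x - x with hh
  have hhsm : ∀ x ∈ closedBall (0 : E) 1, ContDiffAt ℝ 1 h x := fun x hx =>
    (hsm x hx).sub contDiffAt_id
  have hcont : ContinuousOn (fderiv ℝ h) (closedBall (0 : E) 1) := fun x hx =>
    ((hhsm x hx).fderiv_right (m := 0) (by simp)).continuousAt.continuousWithinAt
  obtain ⟨C, hC⟩ := hK.exists_bound_of_continuousOn hcont
  have hC0 : 0 ≤ C := (norm_nonneg _).trans (hC 0 (by simp))
  lift C to NNReal using hC0
  -- The bound `1 / (C + 1)` ensures both `t < 1` and `t * C < 1`.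
  obtain ⟨s, w, hs, hw, hdet⟩ := exists_det_one_add_eq_sum E
    (show (0 : ℝ) < 1 / (C + 1) by positivity)
  have hsmall : ∀ t ∈ s, 0 < t ∧ t < 1 ∧ t * C < 1 := by
    intro t ht
    obtain ⟨h0, h1⟩ := hs t ht
    rw [lt_div_iff₀ (by positivity)] at h1
    have := C.coe_nonneg
    exact ⟨h0, by nlinarith, by nlinarith⟩
  have hint : ∀ t : ℝ, IntegrableOn (fun x => (1 + t • fderiv ℝ h x).det) (ball (0 : E) 1) μ := by
    intro t
    refine (ContinuousOn.integrableOn_compact hK ?_).mono_set ball_subset_closedBall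
    exact ContinuousLinearMap.continuous_det.comp_continuousOn
      (continuousOn_const.add (hcont.const_smul t))
  have hvol : ∀ t ∈ s, ∫ x in ball (0 : E) 1, (1 + t • fderiv ℝ h x).det ∂μ
      = μ.real (ball (0 : E) 1) := by
    intro t ht
    obtain ⟨h0, h1, h2⟩ := hsmall t ht
    obtain ⟨hinj, him⟩ := image_ball_add_smul h0 h1 h2 hhsm hC
      (fun x hx => by simp [hh, hf x hx]) (fun x hx => by simp [hh, hsph x hx])
    have hd : ∀ x ∈ ball (0 : E) 1, HasFDerivWithinAt (fun x => x + t • h x)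
        (1 + t • fderiv ℝ h x) (ball (0 : E) 1) x := fun x hx =>
      ((hasFDerivAt_id x).add ((((hhsm x (ball_subset_closedBall hx)).differentiableAt
        one_ne_zero).hasFDerivAt).const_smul t)).hasFDerivWithinAt
    have := integral_image_eq_integral_abs_det_fderiv_smul μ measurableSet_ball hd
      (hinj.mono ball_subset_closedBall) (fun _ => (1 : ℝ))
    rw [him] at this
    rw [← setIntegral_one_eq_measureReal, this]
    refine setIntegral_congr_fun measurableSet_ball fun x hx => ?_
    have hpos : 0 < (1 + t • fderiv ℝ h x).det := by
      refine (det_one_add_pos ?_).2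
      rw [norm_smul, Real.norm_of_nonneg h0.le]
      nlinarith [hC x (ball_subset_closedBall hx)]
    simp [abs_of_pos hpos]
  have hzero : ∀ x ∈ ball (0 : E) 1, (1 + fderiv ℝ h x).det = 0 := by
    intro x hx
    have hx' := ball_subset_closedBall hx
    have hfd : HasFDerivAt f (fderiv ℝ f x) x :=
      ((hsm x hx').differentiableAt one_ne_zero).hasFDerivAt
    have h1 : 1 + fderiv ℝ h x = fderiv ℝ f x := by
      have : fderiv ℝ h x = fderiv ℝ f x - 1 := (hfd.sub (hasFDerivAt_id x)).fderiv
      rw [this]; abel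
    rw [h1]
    by_contra hne
    -- Since `‖f‖ = 1` on the ball, `f x` is orthogonal to the range of `Df`; if `Df` were onto, `f
    -- x` would be orthogonal to itself.
    obtain ⟨v, hv⟩ := (LinearMap.equivOfDetNeZero (fderiv ℝ f x : E →ₗ[ℝ] E) hne).surjective (f x)
    replace hv : fderiv ℝ f x v = f x := hv
    have h2 : HasFDerivAt (fun y => ‖f y‖ ^ 2) _ x := hfd.norm_sq
    have h3 : HasFDerivAt (fun y => ‖f y‖ ^ 2) (0 : E →L[ℝ] ℝ) x := by
      refine (hasFDerivAt_const (1 : ℝ) x).congr_of_eventuallyEq ?_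
      filter_upwards [isOpen_ball.mem_nhds hx] with y hy
      simp [hf y (ball_subset_closedBall hy)]
    have h4 := congrArg (fun L : E →L[ℝ] ℝ => L v) (h2.unique h3)
    simp [hv, hf x hx'] at h4
  have hfin : ∫ x in ball (0 : E) 1, (1 + fderiv ℝ h x).det ∂μ = μ.real (ball (0 : E) 1) := by
    rw [funext fun x => hdet (fderiv ℝ h x), integral_finsetSum _ fun t _ => (hint t).const_mul _]
    simp_rw [integral_const_mul]
    rw [Finset.sum_congr rfl fun t ht => by rw [hvol t ht], ← Finset.sum_mul, hw, one_mul]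
  rw [setIntegral_eq_zero_of_forall_eq_zero hzero] at hfin
  have : 0 < μ.real (ball (0 : E) 1) :=
    ENNReal.toReal_pos (measure_ball_pos μ 0 one_pos).ne' measure_ball_lt_top.ne
  exact this.ne hfin

/-- Brouwer's fixed point theorem for smooth maps of the closed unit ball. -/
theorem exists_fixedPoint_of_contDiff {p : E → E} (hp : ContDiff ℝ 1 p) (hp1 : ∀ x, ‖p x‖ ≤ 1) :
    ∃ x, ‖x‖ ≤ 1 ∧ p x = x := by
  by_contra! hne
  -- The ray from `p x` through `x` leaves the ball at `x + l x • u x`: `l x` is the larger root of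
  -- `‖u‖² l² + 2⟨x, u⟩ l + ‖x‖² - 1`, and `d x` is a quarter of the discriminant.
  let u : E → E := fun x => x - p x
  let d : E → ℝ := fun x => inner ℝ x (u x) ^ 2 + ‖u x‖ ^ 2 * (1 - ‖x‖ ^ 2)
  let l : E → ℝ := fun x => (-inner ℝ x (u x) + √(d x)) / ‖u x‖ ^ 2
  have hu0 : ∀ x, ‖x‖ ≤ 1 → 0 < ‖u x‖ ^ 2 := fun x hx => by
    have : u x ≠ 0 := sub_ne_zero.2 (hne x hx).symm
    positivity
  -- Positivity here makes `d` positive on the sphere, so that the root is smooth there, and gives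
  -- `l = 0` on the sphere.
  have hin : ∀ x, ‖x‖ = 1 → 0 < inner ℝ x (u x) := by
    intro x hx
    have h1 : ‖x - p x‖ ^ 2 = ‖x‖ ^ 2 - 2 * inner ℝ x (p x) + ‖p x‖ ^ 2 := norm_sub_sq_real x (p x)
    have h2 : inner ℝ x (u x) = 1 - inner ℝ x (p x) := by
      simp [u, inner_sub_right, hx]
    have h3 := hu0 x hx.le
    have h4 := hp1 x
    have h5 := norm_nonneg (p x)
    simp only [u] at h3
    rw [hx] at h1
    nlinarith
  have hd0 : ∀ x, ‖x‖ ≤ 1 → 0 < d x := by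
    intro x hx
    rcases hx.lt_or_eq with h | h
    · have : 0 < 1 - ‖x‖ ^ 2 := by nlinarith [norm_nonneg x]
      have := hu0 x hx
      positivity
    · have := hin x h
      simp only [d, h]
      norm_num
      positivity
  have husm : ContDiff ℝ 1 u := contDiff_id.sub hp
  have hism : ContDiff ℝ 1 fun x => inner ℝ x (u x) := contDiff_id.inner ℝ husm
  have hdsm : ContDiff ℝ 1 d :=
    (hism.pow 2).add ((husm.norm_sq ℝ).mul (contDiff_const.sub (contDiff_id.norm_sq ℝ)))
  refine no_contDiff_retraction (E := E) (f := fun x => x + l x • u x) ?_ ?_ ?_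
  · intro x hx
    rw [mem_closedBall_zero_iff] at hx
    refine contDiffAt_id.add (ContDiffAt.smul ?_ husm.contDiffAt)
    exact (hism.contDiffAt.neg.add (hdsm.contDiffAt.sqrt (hd0 x hx).ne')).div
      (husm.norm_sq ℝ).contDiffAt (hu0 x hx).ne'
  · intro x hx
    rw [mem_closedBall_zero_iff] at hx
    have h1 : ‖x + l x • u x‖ ^ 2
        = ‖x‖ ^ 2 + 2 * (l x * inner ℝ x (u x)) + l x ^ 2 * ‖u x‖ ^ 2 := by
      rw [norm_add_sq_real, inner_smul_right, norm_smul, mul_pow, Real.norm_eq_abs, sq_abs]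
    have h2 : l x * ‖u x‖ ^ 2 = -inner ℝ x (u x) + √(d x) := div_mul_cancel₀ _ (hu0 x hx).ne'
    have h3 : √(d x) ^ 2 = inner ℝ x (u x) ^ 2 + ‖u x‖ ^ 2 * (1 - ‖x‖ ^ 2) :=
      Real.sq_sqrt (hd0 x hx).le
    have h4 : ‖u x‖ ^ 2 * ‖x + l x • u x‖ ^ 2 = ‖u x‖ ^ 2 * 1 := by
      rw [h1]
      have h5 : √(d x) = l x * ‖u x‖ ^ 2 + inner ℝ x (u x) := by rw [h2]; ring
      rw [h5] at h3
      linear_combination h3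
    have h6 := mul_left_cancel₀ (hu0 x hx).ne' h4
    exact (pow_eq_one_iff_of_nonneg (norm_nonneg _) two_ne_zero).1 h6
  · intro x hx
    have h1 : √(d x) = inner ℝ x (u x) := by
      have : d x = inner ℝ x (u x) ^ 2 := by simp [d, hx]
      rw [this, Real.sqrt_sq (hin x hx).le]
    simp [l, h1]

/-- Brouwer's fixed point theorem for continuous maps into the closed unit ball. -/
theorem exists_fixedPoint_of_norm_le_one {f : E → E} (hf : Continuous f) (hf1 : ∀ x, ‖f x‖ ≤ 1) :
    ∃ x, f x = x := by
  by_contra! hne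
  obtain ⟨x₀, -, hmin⟩ := (isCompact_closedBall (0 : E) 1).exists_isMinOn ⟨0, by simp⟩
    (hf.sub continuous_id).norm.continuousOn
  set δ := ‖f x₀ - x₀‖ with hδ
  have hδ0 : 0 < δ := norm_pos_iff.2 (sub_ne_zero.2 (hne x₀))
  -- A smooth `g` within `δ` of `f` has a fixed point in the ball, where `f` would move it by less
  -- than the minimal displacement `δ`.
  obtain ⟨g, hg⟩ := exists_contMDiffMap_forall_mem_convex_of_local_const
    (n := 1) (modelWithCornersSelf ℝ E) (t := fun x => ball (f x) δ ∩ closedBall (0 : E) 1)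
    (fun x => (convex_ball _ _).inter (convex_closedBall _ _)) (fun x => by
      refine ⟨f x, ?_⟩
      filter_upwards [hf.continuousAt.eventually (ball_mem_nhds (f x) hδ0)] with y hy
      exact ⟨mem_ball_comm.1 hy, by simpa using hf1 x⟩)
  obtain ⟨x, hx, hgx⟩ := exists_fixedPoint_of_contDiff (p := g) g.contMDiff.contDiff
    (fun x => by simpa using (hg x).2)
  have h1 : δ ≤ ‖f x - x‖ := hmin (by simpa using hx)
  have h2 := (hg x).1
  rw [hgx, mem_ball, dist_comm, dist_eq_norm] at h2
  exact h2.not_ge h1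

/-- Brouwer's fixed point theorem for the cube. -/
theorem exists_fixedPoint_cube {ι : Type*} [Finite ι] {f : (ι → unitInterval) → ι → unitInterval}
    (hf : Continuous f) : ∃ x, f x = x := by
  have := Fintype.ofFinite ι
  -- The cube lies in the ball of radius `r`; the `+ 1` keeps `r` positive when `ι` is empty. `P`
  -- rescales and clamps to the cube, and clamping is harmless at a fixed point of `G`.
  let r : ℝ := √(Fintype.card ι) + 1
  have hr : 0 < r := by positivity
  let P : EuclideanSpace ℝ ι → ι → unitInterval := fun x i => projIcc 0 1 zero_le_one (r * x i)
  have hP : Continuous P := continuous_pi fun i => continuous_projIcc.comp (by fun_prop)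
  let G : EuclideanSpace ℝ ι → EuclideanSpace ℝ ι := fun x =>
    WithLp.toLp 2 fun i => r⁻¹ * (f (P x) i : ℝ)
  have hG : Continuous G := by
    refine (PiLp.continuous_toLp 2 _).comp (continuous_pi fun i => continuous_const.mul ?_)
    exact continuous_subtype_val.comp ((continuous_apply i).comp (hf.comp hP))
  obtain ⟨x, hx⟩ := exists_fixedPoint_of_norm_le_one hG fun x => by
    have h1 : G x = r⁻¹ • WithLp.toLp 2 fun i => (f (P x) i : ℝ) := rfl
    have h2 : ‖(WithLp.toLp 2 fun i => (f (P x) i : ℝ) : EuclideanSpace ℝ ι)‖ ≤ r := by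
      rw [EuclideanSpace.norm_eq]
      refine (Real.sqrt_le_sqrt ?_).trans (le_add_of_nonneg_right zero_le_one)
      calc ∑ i, ‖(f (P x) i : ℝ)‖ ^ 2 ≤ ∑ _i : ι, (1 : ℝ) := by
            refine Finset.sum_le_sum fun i _ => pow_le_one₀ (norm_nonneg _) ?_
            rw [Real.norm_of_nonneg (f (P x) i).2.1]
            exact (f (P x) i).2.2
        _ = _ := by simp
    rw [h1, norm_smul, norm_inv, Real.norm_of_nonneg hr.le]
    exact inv_mul_le_one_of_le₀ h2 hr.le
  refine ⟨P x, funext fun i => ?_⟩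
  have h1 : r * x i = f (P x) i := by
    conv_lhs => rw [← hx]
    exact mul_inv_cancel_left₀ hr.ne' _
  simp only [P] at h1 ⊢
  rw [h1]
  exact (projIcc_val zero_le_one _).symm

end Brouwer

namespace Argumentation

/-! ### Solutions of the equations and complete extensions -/

section Solutions

theorem ArgumentationFriendly.continuous_eval {S : Type*}
    {g : List unitInterval → unitInterval} (hg : ArgumentationFriendly g)
    (l : List S) :
    Continuous fun V : S → unitInterval => g (l.map fun Y => unitInterval.symm (V Y)) := by
  have h : ∀ V : S → unitInterval, (l.map fun Y => unitInterval.symm (V Y)) =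
      List.ofFn fun i : Fin l.length => unitInterval.symm (V (l.get i)) := by
    intro V
    apply List.ext_get <;> simp
  simp_rw [h]
  exact (hg.continuous l.length).comp
    (continuous_pi fun i => unitInterval.continuous_symm.comp (continuous_apply _))

variable {S : Type*} [Finite S] {R : S → S → Prop} {g : List unitInterval → unitInterval}

theorem mem_attackers {X Y : S} : Y ∈ attackers R X ↔ R Y X := by
  simp [attackers]

theorem ArgumentationFriendly.eval_eq_one_iff (hg : ArgumentationFriendly g) (V : S → unitInterval)
    (X : S) : g ((attackers R X).toList.map fun Y => unitInterval.symm (V Y)) = 1 ↔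
      ∀ Y, R Y X → V Y = 0 := by
  simp [hg.eq_one_iff, mem_attackers]

theorem ArgumentationFriendly.eval_eq_zero_iff (hg : ArgumentationFriendly g)
    (V : S → unitInterval) (X : S) :
    g ((attackers R X).toList.map fun Y => unitInterval.symm (V Y)) = 0 ↔
      ∃ Y, R Y X ∧ V Y = 1 := by
  simp [hg.eq_zero_iff, mem_attackers]

/-- The nodes of value `1` in a solution form a complete extension. -/
theorem IsSolution.completeExtension (hg : ArgumentationFriendly g) {V : S → unitInterval}
    (hV : IsSolution R g V) : CompleteExtension R {X | V X = 1} := by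
  have h1 : ∀ X, V X = 1 ↔ ∀ Y, R Y X → V Y = 0 := fun X => by
    conv_lhs => rw [hV X]
    exact hg.eval_eq_one_iff V X
  have h0 : ∀ X, V X = 0 ↔ ∃ Y, R Y X ∧ V Y = 1 := fun X => by
    conv_lhs => rw [hV X]
    exact hg.eval_eq_zero_iff V X
  refine ⟨⟨fun X hX Y hY hXY => ?_, fun X hX Y hYX => ?_⟩, fun X hX => ?_⟩
  · exact zero_ne_one (((h1 Y).1 hY X hXY).symm.trans hX)
  · obtain ⟨Z, hZ, hZ1⟩ := (h0 Y).1 ((h1 X).1 hX Y hYX)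
    exact ⟨Z, hZ1, hZ⟩
  · refine (h1 X).2 fun Y hY => (h0 Y).2 ?_
    obtain ⟨Z, hZ1, hZ⟩ := hX Y hY
    exact ⟨Z, hZ, hZ1⟩

open Classical in
/-- Every admissible set takes the value `1` in some solution. -/
theorem Admissible.exists_isSolution (hg : ArgumentationFriendly g) {E : Set S}
    (hE : Admissible R E) : ∃ V : S → unitInterval, IsSolution R g V ∧
      (∀ X ∈ E, V X = 1) ∧ ∀ X, SetAttacks R E X → V X = 0 := by
  -- The case split depends on `X` only, not on `V`, so continuity holds coordinatewise.
  obtain ⟨V, hV⟩ := exists_fixedPoint_cube (ι := S)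
    (f := fun V X => if X ∈ E then 1 else if SetAttacks R E X then 0 else
      g ((attackers R X).toList.map fun Y => unitInterval.symm (V Y)))
    (continuous_pi fun X => by
      split_ifs
      · exact continuous_const
      · exact continuous_const
      · exact hg.continuous_eval _)
  have h1 : ∀ X ∈ E, V X = 1 := fun X hX => by
    rw [← hV]
    simp [hX]
  have h0 : ∀ X, SetAttacks R E X → V X = 0 := fun X hX => by
    have hXE : X ∉ E := fun h => by
      obtain ⟨Y, hY, hYX⟩ := hX
      exact hE.1 Y hY X h hYX
    rw [← hV]
    simp [hX, hXE]
  refine ⟨V, fun X => ?_, h1, h0⟩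
  by_cases hXE : X ∈ E
  · rw [h1 X hXE, eq_comm, hg.eval_eq_one_iff]
    exact fun Y hY => h0 Y (hE.2 X hXE Y hY)
  · by_cases hX : SetAttacks R E X
    · rw [h0 X hX, eq_comm, hg.eval_eq_zero_iff]
      obtain ⟨Y, hY, hYX⟩ := hX
      exact ⟨Y, hYX, h1 Y hY⟩
    · conv_lhs => rw [← hV]
      simp [hXE, hX]

end Solutions

end Argumentation

theorem mainTheorem3 {S : Type*} [Finite S] (R : S → S → Prop)
    (g : List unitInterval → unitInterval) (hg : Argumentation.ArgumentationFriendly g)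
    (E : Set S) (hE : Argumentation.PreferredExtension R E) :
    ∃ V : S → unitInterval, Argumentation.IsSolution R g V ∧
      (∀ X, X ∈ E → V X = 1) ∧
      (∀ X, Argumentation.SetAttacks R E X → V X = 0) ∧
      (∀ X, X ∉ E → ¬ Argumentation.SetAttacks R E X → 0 < V X ∧ V X < 1) := by
  obtain ⟨V, hV, h1, h0⟩ := hE.prop.1.exists_isSolution hg
  -- Maximality of `E` against the larger complete extension `{X | V X = 1}`.
  have hone : ∀ X, V X = 1 → X ∈ E :=
    hE.le_of_ge (hV.completeExtension hg) (fun X hX => h1 X hX)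
  refine ⟨V, hV, h1, h0, fun X hX hEX => ⟨?_, ?_⟩⟩
  · refine unitInterval.pos_iff_ne_zero.2 fun h => hEX ?_
    rw [hV X, hg.eval_eq_zero_iff] at h
    obtain ⟨Y, hY, hY1⟩ := h
    exact ⟨Y, hone Y hY1, hY⟩
  · exact unitInterval.lt_one_iff_ne_one.2 fun h => hX (hone X h)
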